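/- Let $M$ be a smooth, Hausdorff, finite-dimensional manifold (without boundary) and let $\boldsymbol\eta=\sum_{\mu=1}^k\eta^\mu\otimes e_\mu\in\Omega^1(M,\mathbb R^k)$ be a $k$-contact form on $M$: $\ker\boldsymbol\eta$ is a nonzero distribution of constant corank $k$, $\ker\mathrm d\boldsymbol\eta$ is a distribution of constant rank $k$, and $\ker\boldsymbol\eta\cap\ker\mathrm d\boldsymbol\eta=0$. Let $R_1,\dots,R_k$ be its Reeb vector fields, i.e. the unique ones with $\iota_{R_\mu}\eta^\nu=\delta_\mu^\nu$ and $\iota_{R_\mu}\mathrm d\eta^\nu=0$. A smooth vector field $Y$ on $M$ is called $\boldsymbol\eta$-Hamiltonian if it is a Lie symmetry of $\ker\boldsymbol\eta$ (i.e. $[Y,Z]$ takes values in $\ker\boldsymbol\eta$ for every smooth, possibly only locally defined, vector field $Z$ with values in $\ker\boldsymbol\eta$); its $\boldsymbol\eta$-Hamiltonian $k$-function is $\boldsymbol h=-\iota_Y\boldsymbol\eta\colon M\to\mathbb R^k$, and the Reeb derivation of $\boldsymbol h=(h^1,\dots,h^k)$ is the vector field $R_{\boldsymbol h}=\sum_{\mu=1}^k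 h^\mu R_\mu$. The bracket of the $\boldsymbol\eta$-Hamiltonian $k$-functions $\boldsymbol h,\boldsymbol h'$ of $Y,Y'$ is $\{\boldsymbol h,\boldsymbol h'\}_{\boldsymbol\eta}=\boldsymbol\eta([Y,Y'])$. Let $X$ be a $k$-contact Lie system on $M$ with an $r$-dimensional Vessiot--Guldberg Lie algebra of $\boldsymbol\eta$-Hamiltonian vector fields: $X(t,x)=\sum_{\alpha=1}^r b_\alpha(t)X_\alpha(x)$, where $b_1,\dots,b_r\colon\mathbb R\to\mathbb R$ are continuous and $X_1,\dots,X_r$ are $\boldsymbol\eta$-Hamiltonian vector fields forming a basis of an $r$-dimensional real Lie algebra of vector fields. Let $\boldsymbol h_1,\dots,\boldsymbol h_r$ be the $\boldsymbol\eta$-Hamiltonian $k$-functions of $X_1,\dots,X_r$, and let $\mathfrak W=\langle\boldsymbol h_1,\dots,\boldsymbol h_r\rangle$, with the bracket $\{\cdot,\cdot\}_{\boldsymbol\eta}$, be isomorphic to an abstract $r$-dimensional real Lie algebra $\mathfrak g$. Let $\{v^1,\dots,v^r\}$ be a basis of $\mathfrak g^*$ and define the momentum map $$\boldsymbol J\colon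 M\to\mathfrak g^*\otimes\mathbb R^k,\qquad \boldsymbol J(x)=\sum_{\alpha=1}^r v^\alpha\otimes\boldsymbol h_\alpha(x).$$ Let $\theta\in(\mathbb R^k)^*$, let $J^\theta=\langle\boldsymbol J,\theta\rangle\colon M\to\mathfrak g^*$, and let $S=(J^\theta)^{-1}(0)$. Assume that $S$ is an embedded submanifold of $M$ with $\mathrm T_xS=\ker\mathrm T_xJ^\theta$ for every $x\in S$ (i.e. $0$ is a weakly regular value of $J^\theta$), and that the Reeb derivations $R_{\boldsymbol h_1},\dots,R_{\boldsymbol h_r}$ are tangent to $S$ at all points of $S$. Then $S$ is invariant under the dynamics of $X$: every solution $\gamma$ of $\dot x=X(t,x)$ defined on an interval, with $\gamma(t_0)\in S$ for some $t_0$ in that interval, satisfies $\gamma(t)\in S$ for all $t$ in that interval. -/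

import Mathlib

open scoped Manifold ContDiff TensorProduct Topology

namespace KContact

noncomputable section

section Geometry

variable {E : Type*} [NormedAddCommGroup E] [NormedSpace ℝ E]
  {M : Type*} [TopologicalSpace M] [ChartedSpace E M]
  {F : Type*} [NormedAddCommGroup F] [NormedSpace ℝ F]

/-- Vector fields (not necessarily smooth) on the boundaryless manifold `M` modelled on `E`. -/
abbrev VField (E : Type*) [NormedAddCommGroup E] [NormedSpace ℝ E]
    (M : Type*) [TopologicalSpace M] [ChartedSpace E M] : Type _ :=
  (x : M) → TangentSpace 𝓘(ℝ, E) x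

/-- One-forms (not necessarily smooth) on `M` with values in `F`. -/
abbrev OneForm (E : Type*) [NormedAddCommGroup E] [NormedSpace ℝ E]
    (M : Type*) [TopologicalSpace M] [ChartedSpace E M]
    (F : Type*) [NormedAddCommGroup F] [NormedSpace ℝ F] : Type _ :=
  (x : M) → TangentSpace 𝓘(ℝ, E) x →L[ℝ] F

/-- The vector field `X` is smooth on the set `U`. -/
def SmoothVFieldOn [IsManifold 𝓘(ℝ, E) ∞ M] (X : VField E M) (U : Set M) : Prop :=
  ContMDiffOn 𝓘(ℝ, E) 𝓘(ℝ, E).tangent ∞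
    (fun x ↦ (⟨x, X x⟩ : TangentBundle 𝓘(ℝ, E) M)) U

/-- The vector field `X` is smooth. -/
def SmoothVField [IsManifold 𝓘(ℝ, E) ∞ M] (X : VField E M) : Prop :=
  ContMDiff 𝓘(ℝ, E) 𝓘(ℝ, E).tangent ∞
    (fun x ↦ (⟨x, X x⟩ : TangentBundle 𝓘(ℝ, E) M))

/-- The one-form `η` is smooth, as a section of `Hom(TM, M × F)`. -/
def SmoothOneForm [IsManifold 𝓘(ℝ, E) ∞ M] (η : OneForm E M F) : Prop :=
  haveI : IsManifold 𝓘(ℝ, E) 1 M := IsManifold.of_le (n := ∞) (by norm_cast)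
  ContMDiff 𝓘(ℝ, E) (𝓘(ℝ, E).prod 𝓘(ℝ, E →L[ℝ] F)) ∞
    (fun x ↦ Bundle.TotalSpace.mk' (E →L[ℝ] F)
      (E := fun y : M ↦ (TangentSpace 𝓘(ℝ, E) y →L[ℝ] Bundle.Trivial M F y)) x (η x))

/-- The expression of the one-form `η` in the preferred chart at `x₀`, i.e. its pullback
by the inverse of the chart. -/
def chartRep (η : OneForm E M F) (x₀ : M) (u : E) : E →L[ℝ] F :=
  (η ((extChartAt 𝓘(ℝ, E) x₀).symm u)).comp
    (mfderiv 𝓘(ℝ, E) 𝓘(ℝ, E) (extChartAt 𝓘(ℝ, E) x₀).symm u)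

/-- The exterior derivative of a one-form at `x`, as a bilinear map: in the chart at `x` it is
`dη(v, w) = (D_v η)(w) - (D_w η)(v)`. -/
def extD (η : OneForm E M F) (x : M) :
    TangentSpace 𝓘(ℝ, E) x →L[ℝ] TangentSpace 𝓘(ℝ, E) x →L[ℝ] F :=
  let D : E →L[ℝ] E →L[ℝ] F := fderiv ℝ (chartRep η x) (extChartAt 𝓘(ℝ, E) x x)
  let L : E →L[ℝ] E := mfderiv 𝓘(ℝ, E) 𝓘(ℝ, E) (extChartAt 𝓘(ℝ, E) x) x
  show E →L[ℝ] E →L[ℝ] F from (D - D.flip).bilinearComp L L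

/-- `η` is a `k`-contact form on `M`: `ker η` is a nonzero distribution of corank `k`, `ker dη`
has rank `k`, and the two intersect trivially. -/
structure IsKContactForm [IsManifold 𝓘(ℝ, E) ∞ M] {k : ℕ} (η : OneForm E M (Fin k → ℝ)) :
    Prop where
  smooth : SmoothOneForm η
  ker_ne_bot : ∀ x, (η x).ker ≠ ⊥
  corank_ker : ∀ x, Module.finrank ℝ (TangentSpace 𝓘(ℝ, E) x ⧸ (η x).ker) = k
  rank_ker_extD : ∀ x, Module.finrank ℝ (extD η x).ker = k
  ker_inf_ker : ∀ x, (η x).ker ⊓ (extD η x).ker = ⊥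

/-- The `μ`-th Reeb vector field of `η`: its value at `x` is the vector `v` with `η(v) = e_μ` and
`ι_v dη = 0` (see `reeb_spec` and `reeb_unique`). -/
def reeb {k : ℕ} (η : OneForm E M (Fin k → ℝ)) (μ : Fin k) : VField E M := fun x ↦
  Classical.epsilon fun v : TangentSpace 𝓘(ℝ, E) x ↦ η x v = Pi.single μ 1 ∧ extD η x v = 0

/-- The Reeb derivation `R_h = ∑ μ, h^μ R_μ` of an `ℝ^k`-valued function. -/
def reebDerivation {k : ℕ} (η : OneForm E M (Fin k → ℝ)) (h : M → Fin k → ℝ) : VField E M :=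
  fun x ↦ ∑ μ, h x μ • reeb η μ x

/-- `X` is a Lie symmetry of the distribution `ker η`: its Lie bracket with every (locally defined)
smooth vector field with values in `ker η` takes values in `ker η`. -/
def IsLieSymmetryKer [IsManifold 𝓘(ℝ, E) ∞ M] (η : OneForm E M F) (X : VField E M) : Prop :=
  ∀ (U : Set M) (Y : VField E M), IsOpen U → SmoothVFieldOn Y U → (∀ x ∈ U, η x (Y x) = 0) →
    ∀ x ∈ U, η x (VectorField.mlieBracket 𝓘(ℝ, E) X Y x) = 0

/-- `X` is an `η`-Hamiltonian vector field with `η`-Hamiltonian `k`-function `h = -ι_X η`. -/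
structure IsHamiltonian [IsManifold 𝓘(ℝ, E) ∞ M] {k : ℕ} (η : OneForm E M (Fin k → ℝ))
    (X : VField E M) (h : M → Fin k → ℝ) : Prop where
  smooth : SmoothVField X
  lieSymmetry : IsLieSymmetryKer η X
  eq_neg : ∀ x, h x = -η x (X x)

/-- `f = {h₁, h₂}_η`, i.e. `f = η([X₁, X₂])`, where `X₁`, `X₂` are the `η`-Hamiltonian vector
fields of `h₁`, `h₂`. -/
def IsBracket [IsManifold 𝓘(ℝ, E) ∞ M] {k : ℕ} (η : OneForm E M (Fin k → ℝ))
    (h₁ h₂ f : M → Fin k → ℝ) : Prop :=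
  ∃ X₁ X₂ : VField E M, IsHamiltonian η X₁ h₁ ∧ IsHamiltonian η X₂ h₂ ∧
    ∀ x, f x = η x (VectorField.mlieBracket 𝓘(ℝ, E) X₁ X₂ x)

/-- The smooth vector fields `Xs 1, …, Xs r` are a basis of an `r`-dimensional real Lie algebra of
vector fields and `X(t, x) = ∑ α, b_α(t) Xs_α(x)` for continuous functions `b_α`. That is, `X` is a
Lie system and `Xs` is a basis of a Vessiot–Guldberg Lie algebra of `X`. -/
structure IsLieSystemWith [IsManifold 𝓘(ℝ, E) ∞ M] {r : ℕ} (X : ℝ → VField E M)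
    (Xs : Fin r → VField E M) : Prop where
  smooth : ∀ α, SmoothVField (Xs α)
  linearIndependent : LinearIndependent ℝ Xs
  bracket_mem : ∀ α β, VectorField.mlieBracket 𝓘(ℝ, E) (Xs α) (Xs β) ∈
    Submodule.span ℝ (Set.range Xs)
  decomposition : ∃ b : Fin r → ℝ → ℝ, (∀ α, Continuous (b α)) ∧
    ∀ t x, X t x = ∑ α, b α t • Xs α x

/-- `γ` is a solution on the set of times `s` of the system `dx/dt = X(t, x)`. -/
def IsSolutionOn (X : ℝ → VField E M) (γ : ℝ → M) (s : Set ℝ) : Prop :=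
  ∀ t ∈ s, HasMFDerivWithinAt 𝓘(ℝ, ℝ) 𝓘(ℝ, E) γ s t
    ((1 : ℝ →L[ℝ] ℝ).smulRight (X t (γ t)))

/-- `S` is invariant under the dynamics of `X`: a solution defined on an interval which meets `S`
at some time is in `S` at all times. -/
def IsInvariantUnder (X : ℝ → VField E M) (S : Set M) : Prop :=
  ∀ (s : Set ℝ) (γ : ℝ → M), s.OrdConnected → IsSolutionOn X γ s →
    ∀ t₀ ∈ s, γ t₀ ∈ S → ∀ t ∈ s, γ t ∈ S

/-- `S` is an embedded smooth submanifold of `M`: around each of its points there is a smooth chart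
in which `S` is a piece of an affine subspace. -/
def IsEmbeddedSubmanifold (E : Type*) [NormedAddCommGroup E] [NormedSpace ℝ E]
    {M : Type*} [TopologicalSpace M] [ChartedSpace E M] (S : Set M) : Prop :=
  ∀ x ∈ S, ∃ φ ∈ IsManifold.maximalAtlas 𝓘(ℝ, E) ∞ M, x ∈ φ.source ∧
    ∃ P : Submodule ℝ E, ∀ y ∈ φ.source, y ∈ S ↔ φ y - φ x ∈ P

/-- `v` is tangent to `S` at `x`: it is the velocity at `0` of a curve through `x` that is
smooth near `0` and takes values in `S` there. -/
def IsTangentAt (S : Set M) (x : M) (v : TangentSpace 𝓘(ℝ, E) x) : Prop :=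
  ∃ γ : ℝ → M, γ 0 = x ∧ ContMDiffAt 𝓘(ℝ, ℝ) 𝓘(ℝ, E) ∞ γ 0 ∧ (∀ᶠ t in 𝓝 0, γ t ∈ S) ∧
    HasMFDerivAt 𝓘(ℝ, ℝ) 𝓘(ℝ, E) γ 0 ((1 : ℝ →L[ℝ] ℝ).smulRight (show E from v))

end Geometry

section MomentumMap

variable {M : Type*} {𝔤 : Type*} [LieRing 𝔤] [LieAlgebra ℝ 𝔤] {r k : ℕ}

/-- The momentum map `J(x) = ∑ α, v^α ⊗ h_α(x) ∈ 𝔤* ⊗ ℝ^k`. -/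
def momentumMap (v : Module.Basis (Fin r) ℝ (Module.Dual ℝ 𝔤)) (h : Fin r → M → Fin k → ℝ)
    (x : M) : Module.Dual ℝ 𝔤 ⊗[ℝ] (Fin k → ℝ) :=
  ∑ α, v α ⊗ₜ[ℝ] h α x

/-- The contraction `J^θ = ⟨J, θ⟩ : M → 𝔤*` of the momentum map with `θ ∈ (ℝ^k)*`. -/
def momentumMapAlong (v : Module.Basis (Fin r) ℝ (Module.Dual ℝ 𝔤)) (h : Fin r → M → Fin k → ℝ)
    (θ : Module.Dual ℝ (Fin k → ℝ)) (x : M) : Module.Dual ℝ 𝔤 :=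
  TensorProduct.rid ℝ (Module.Dual ℝ 𝔤)
    (LinearMap.lTensor (Module.Dual ℝ 𝔤) θ (momentumMap v h x))

/-- The zero level of `J^θ`. -/
def zeroLevel (v : Module.Basis (Fin r) ℝ (Module.Dual ℝ 𝔤)) (h : Fin r → M → Fin k → ℝ)
    (θ : Module.Dual ℝ (Fin k → ℝ)) : Set M :=
  {x | momentumMapAlong v h θ x = 0}

end MomentumMap

section Reeb

variable {E : Type*} [NormedAddCommGroup E] [NormedSpace ℝ E]
  {M : Type*} [TopologicalSpace M] [ChartedSpace E M] [IsManifold 𝓘(ℝ, E) ∞ M]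
  {k : ℕ} {η : OneForm E M (Fin k → ℝ)}

theorem reeb_unique (hη : IsKContactForm η) (x : M) {v w : TangentSpace 𝓘(ℝ, E) x}
    (hvw : η x v = η x w) (hv : extD η x v = 0) (hw : extD η x w = 0) : v = w := by
  have h : v - w ∈ (η x).ker ⊓ (extD η x).ker :=
    ⟨by simp [LinearMap.mem_ker, hvw], by simp [LinearMap.mem_ker, hv, hw]⟩
  rw [hη.ker_inf_ker x] at h
  exact sub_eq_zero.mp ((Submodule.mem_bot ℝ).mp h)

theorem reeb_spec [FiniteDimensional ℝ E] (hη : IsKContactForm η) (μ : Fin k) (x : M) :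
    η x (reeb η μ x) = Pi.single μ 1 ∧ extD η x (reeb η μ x) = 0 := by
  let g : (extD η x).ker →ₗ[ℝ] (Fin k → ℝ) := (η x).toLinearMap.domRestrict (extD η x).ker
  have hinj : Function.Injective g := by
    intro a b hab
    exact Subtype.ext (reeb_unique hη x hab a.2 b.2)
  have : FiniteDimensional ℝ (TangentSpace 𝓘(ℝ, E) x) := inferInstanceAs (FiniteDimensional ℝ E)
  have hsurj : Function.Surjective g :=
    (LinearMap.injective_iff_surjective_of_finrank_eq_finrank
      (by rw [hη.rank_ker_extD x]; simp)).mp hinj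
  obtain ⟨a, ha⟩ := hsurj (Pi.single μ 1)
  exact Classical.epsilon_spec
    (p := fun v : TangentSpace 𝓘(ℝ, E) x ↦ η x v = Pi.single μ 1 ∧ extD η x v = 0)
    ⟨a.1, ha, a.2⟩

end Reeb

end

end KContact

/-! If `X` is a Lie symmetry of `ker η`, then `dη(X, w) = -d(ι_X η)(w)` for `w ∈ ker η`: extend `w`
to a local section of `ker η` and use the invariant formula for `dη`. For Hamiltonian fields `X_α`,
`X_β` with functions `h_α`, `h_β`, the vector `w = X_β + R_{h_β}` lies in `ker η`, because
`η(R_{h_β}) = h_β = -η(X_β)`. As `ι_{R_{h_β}} dη = 0`, this gives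
`X_α(h_β) = -η([X_α, X_β]) - R_{h_β}(h_α)`.

Now apply `θ` at a point of `S`. The bracket is a combination of the `X_γ`, on which `θ ∘ η`
vanishes, and `R_{h_β}` is tangent to `S`, where `θ ∘ h_α = 0`. So `X_α` annihilates all `θ ∘ h_β`,
and weak regularity makes `X_α` tangent to `S`. Finally `S` is closed and embedded: in a slice chart
the transverse component of a solution satisfies a linear differential inequality and hence
vanishes, so the set of times spent in `S` is open and closed.
-/

namespace KContact

section LinearODE

variable {E : Type*} [NormedAddCommGroup E] [NormedSpace ℝ E]

theorem eq_zero_of_norm_deriv_le_of_le {f f' : ℝ → E} {s : Set ℝ} {a b K : ℝ}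
    (hs : s.OrdConnected) (hf : ∀ t ∈ s, HasDerivWithinAt f (f' t) s t)
    (hK : ∀ t ∈ s, ‖f' t‖ ≤ K * ‖f t‖) (ha : a ∈ s) (hb : b ∈ s) (hab : a ≤ b) (h₀ : f a = 0) :
    f b = 0 := by
  have hsub : Set.Icc a b ⊆ s := hs.out ha hb
  refine eq_zero_of_abs_deriv_le_mul_abs_self_of_eq_zero_right (f' := f') (K := K)
    (fun t ht ↦ ((hf t (hsub ht)).mono hsub).continuousWithinAt) (fun t ht ↦ ?_) h₀
    (fun t ht ↦ hK t (hsub (Set.Ico_subset_Icc_self ht))) b (Set.right_mem_Icc.2 hab)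
  exact ((hf t (hsub (Set.Ico_subset_Icc_self ht))).mono
    ((Set.Icc_subset_Icc_left ht.1).trans hsub)).mono_of_mem_nhdsWithin (Icc_mem_nhdsGE ht.2)

theorem eqOn_zero_of_norm_deriv_le {f f' : ℝ → E} {s : Set ℝ} {t₀ K : ℝ} (hs : s.OrdConnected)
    (ht₀ : t₀ ∈ s) (hf : ∀ t ∈ s, HasDerivWithinAt f (f' t) s t)
    (hK : ∀ t ∈ s, ‖f' t‖ ≤ K * ‖f t‖) (h₀ : f t₀ = 0) : Set.EqOn f 0 s := by
  intro t ht
  rcases le_total t₀ t with hle | hle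
  · exact eq_zero_of_norm_deriv_le_of_le hs hf hK ht₀ ht hle h₀
  · have hderiv : ∀ τ ∈ -s, HasDerivWithinAt (fun σ ↦ f (-σ)) (-f' (-τ)) (-s) τ := fun τ hτ ↦ by
      simpa using! (hf (-τ) hτ).scomp τ (hasDerivWithinAt_neg τ (-s)) fun σ hσ ↦ hσ
    have hneg : (-s).OrdConnected := hs.preimage_anti fun _ _ ↦ neg_le_neg
    simpa using eq_zero_of_norm_deriv_le_of_le (a := -t₀) (b := -t) hneg hderiv
      (fun τ hτ ↦ by simpa using hK (-τ) hτ) (by simpa using ht₀) (by simpa using ht)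
      (neg_le_neg hle) (by simpa using h₀)

theorem eventually_eq_zero_of_norm_deriv_le {f f' : ℝ → E} {s : Set ℝ} {t₀ K : ℝ}
    (hs : s.OrdConnected) (ht₀ : t₀ ∈ s)
    (hf : ∀ᶠ t in 𝓝[s] t₀, HasDerivWithinAt f (f' t) s t ∧ ‖f' t‖ ≤ K * ‖f t‖)
    (h₀ : f t₀ = 0) : ∀ᶠ t in 𝓝[s] t₀, f t = 0 := by
  obtain ⟨ε, hε, hball⟩ := Metric.mem_nhdsWithin_iff.1 hf
  have hconn : (Metric.ball t₀ ε ∩ s).OrdConnected := by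
    rw [Real.ball_eq_Ioo]; exact Set.ordConnected_Ioo.inter hs
  have hzero := eqOn_zero_of_norm_deriv_le hconn ⟨Metric.mem_ball_self hε, ht₀⟩
    (fun t ht ↦ (hball ht).1.mono Set.inter_subset_right) (fun t ht ↦ (hball ht).2) h₀
  exact Metric.mem_nhdsWithin_iff.2 ⟨ε, hε, hzero⟩

/- With `p` a projection onto `P`, the component `f` of `c - c t₀` along `ker p` satisfies
`‖f'‖ ≤ K‖f‖`: `V` is Lipschitz and takes values in `P` at the projection of `c` onto the affine
subspace. -/
theorem eventually_sub_mem_of_lipschitzOnWith {V : ℝ → E → E} {c : ℝ → E} {s : Set ℝ} {t₀ : ℝ}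
    {P : Submodule ℝ E} {T : Set E} {K : NNReal} (hP : P.ClosedComplemented) (hT : T ∈ 𝓝 (c t₀))
    (hV : ∀ᶠ t in 𝓝[s] t₀, LipschitzOnWith K (V t) T)
    (hVP : ∀ u ∈ T, u - c t₀ ∈ P → ∀ t, V t u ∈ P) (hs : s.OrdConnected) (ht₀ : t₀ ∈ s)
    (hc : ∀ᶠ t in 𝓝[s] t₀, HasDerivWithinAt c (V t (c t)) s t) :
    ∀ᶠ t in 𝓝[s] t₀, c t - c t₀ ∈ P := by
  obtain ⟨p, hp⟩ := hP
  let q : E →L[ℝ] E := .id ℝ E - P.subtypeL ∘L p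
  have hq : ∀ u, u = p u + q u := fun u ↦ by simp [q]
  have hqP : ∀ u, q u = 0 ↔ u ∈ P := fun u ↦
    ⟨fun h ↦ by rw [hq u, h, add_zero]; exact (p u).2,
      fun h ↦ by simpa [hp ⟨u, h⟩] using hq u⟩
  let proj : E → E := fun u ↦ c t₀ + p (u - c t₀)
  have hproj : Filter.Tendsto proj (𝓝 (c t₀)) (𝓝 (c t₀)) := by
    simpa [ContinuousAt, proj] using
      (show ContinuousAt (fun u ↦ c t₀ + (p (u - c t₀) : E)) (c t₀) by fun_prop)
  have hcont : ContinuousWithinAt c s t₀ := (hc.self_of_nhdsWithin ht₀).continuousWithinAt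
  suffices h : ∀ᶠ t in 𝓝[s] t₀, q (c t - c t₀) = 0 from h.mono fun t ↦ (hqP _).1
  refine eventually_eq_zero_of_norm_deriv_le (f' := fun t ↦ q (V t (c t))) (K := ‖q‖ * K) hs ht₀
    ?_ (by simp)
  filter_upwards [hc, hV, hcont hT, hcont (hproj hT)] with t hct hLip hT₁ hT₂
  refine ⟨q.hasFDerivAt.comp_hasDerivWithinAt t (hct.sub_const _), ?_⟩
  have hVproj : q (V t (proj (c t))) = 0 := (hqP _).2 (hVP _ hT₂ (by simp [proj, -map_sub]) t)
  have hdist : c t - proj (c t) = q (c t - c t₀) := by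
    rw [← sub_sub, sub_eq_iff_eq_add']; exact hq _
  calc ‖q (V t (c t))‖ = ‖q (V t (c t) - V t (proj (c t)))‖ := by rw [map_sub, hVproj, sub_zero]
    _ ≤ ‖q‖ * (K * ‖c t - proj (c t)‖) :=
      q.le_opNorm_of_le (hLip.norm_sub_le hT₁ hT₂)
    _ = ‖q‖ * K * ‖q (c t - c t₀)‖ := by rw [hdist, mul_assoc]

theorem exists_eventually_lipschitzOnWith_sum_smul {ι : Type*} [Fintype ι] {V : ι → E → E}
    {b : ι → ℝ → ℝ} {u₀ : E} {t₀ : ℝ} (hV : ∀ α, ContDiffAt ℝ 1 (V α) u₀)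
    (hb : ∀ α, ContinuousAt (b α) t₀) :
    ∃ K : NNReal, ∃ T ∈ 𝓝 u₀, ∀ᶠ t in 𝓝 t₀, LipschitzOnWith K (fun u ↦ ∑ α, b α t • V α u) T := by
  let Φ : (ι → ℝ) × E → E := fun p ↦ ∑ α, p.1 α • V α p.2
  have hΦ : ContDiffAt ℝ 1 Φ (fun α ↦ b α t₀, u₀) := ContDiffAt.sum fun α _ ↦
    ContDiffAt.smul (by fun_prop) ((hV α).comp (fun α ↦ b α t₀, u₀) contDiffAt_snd)
  obtain ⟨K, N, hN, hLip⟩ := hΦ.exists_lipschitzOnWith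
  obtain ⟨B, hB, T, hT, hBT⟩ := mem_nhds_prod_iff.1 hN
  have hbB : ∀ᶠ t in 𝓝 t₀, (fun α ↦ b α t) ∈ B := (continuousAt_pi.2 hb).eventually_mem hB
  refine ⟨K, T, hT, hbB.mono fun t ht ↦ ?_⟩
  simpa using! hLip.comp (LipschitzWith.prodMk_left (fun α ↦ b α t)).lipschitzOnWith
    fun u hu ↦ hBT ⟨ht, hu⟩

end LinearODE

section ChartRepresentation

variable {E : Type*} [NormedAddCommGroup E] [NormedSpace ℝ E]
  {M : Type*} [TopologicalSpace M] [ChartedSpace E M]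

/-- The expression in the chart `φ` of the vector field `X`, i.e. its pushforward by `φ`. -/
noncomputable def vFieldRep (φ : OpenPartialHomeomorph M E) (X : VField E M) (u : E) : E :=
  mfderiv 𝓘(ℝ, E) 𝓘(ℝ, E) φ (φ.symm u) (X (φ.symm u))

/-- The vector field on the domain of the chart `φ` whose expression in `φ` is `W`, i.e. the
pullback of `W` by `φ`. -/
noncomputable def vFieldOfRep (φ : OpenPartialHomeomorph M E) (W : E → E) : VField E M := fun y ↦
  mfderiv 𝓘(ℝ, E) 𝓘(ℝ, E) φ.symm (φ y) (W (φ y))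

variable {φ : OpenPartialHomeomorph M E}

theorem mdifferentiable_of_mem_maximalAtlas (hφ : φ ∈ IsManifold.maximalAtlas 𝓘(ℝ, E) ∞ M) :
    φ.MDifferentiable 𝓘(ℝ, E) 𝓘(ℝ, E) :=
  ⟨(contMDiffOn_of_mem_maximalAtlas hφ).mdifferentiableOn (by norm_cast),
    (contMDiffOn_symm_of_mem_maximalAtlas hφ).mdifferentiableOn (by norm_cast)⟩

theorem vFieldRep_vFieldOfRep (hφ : φ ∈ IsManifold.maximalAtlas 𝓘(ℝ, E) ∞ M) (W : E → E) {u : E}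
    (hu : u ∈ φ.target) : vFieldRep φ (vFieldOfRep φ W) u = W u := by
  have h := (mdifferentiable_of_mem_maximalAtlas hφ).comp_symm_deriv hu
  unfold vFieldRep vFieldOfRep
  rw [φ.right_inv hu]
  exact congrArg (fun L : E →L[ℝ] E ↦ L (W u)) h

variable [IsManifold 𝓘(ℝ, E) ∞ M]

theorem isManifold_one : IsManifold 𝓘(ℝ, E) 1 M := IsManifold.of_le (n := ∞) (by norm_cast)

theorem contDiffOn_vFieldRep (hφ : φ ∈ IsManifold.maximalAtlas 𝓘(ℝ, E) ∞ M) {X : VField E M}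
    {U : Set M} (hX : SmoothVFieldOn X U) :
    ContDiffOn ℝ ∞ (vFieldRep φ X) (φ.target ∩ φ.symm ⁻¹' U) := by
  have := isManifold_one (E := E) (M := M)
  have htangent := (contMDiffOn_of_mem_maximalAtlas hφ).contMDiffOn_tangentMapWithin (m := ∞)
    (by norm_cast) φ.open_source.uniqueMDiffOn
  have hsection := hX.comp ((contMDiffOn_symm_of_mem_maximalAtlas hφ).mono
    (Set.inter_subset_left (t := φ.symm ⁻¹' U))) fun u hu ↦ hu.2
  refine contMDiffOn_vectorSpace_iff_contDiffOn.1
    ((htangent.comp hsection fun u hu ↦ φ.map_target hu.1).congr fun u hu ↦ ?_)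
  simp only [Function.comp_def, tangentMapWithin,
    mfderivWithin_of_isOpen φ.open_source (φ.map_target hu.1)]
  congr 1
  exact (φ.right_inv hu.1).symm

theorem smoothVFieldOn_vFieldOfRep (hφ : φ ∈ IsManifold.maximalAtlas 𝓘(ℝ, E) ∞ M) {W : E → E}
    {U : Set E} (hU : IsOpen U) (hUφ : U ⊆ φ.target) (hW : ContDiffOn ℝ ∞ W U) :
    SmoothVFieldOn (vFieldOfRep φ W) (φ.source ∩ φ ⁻¹' U) := by
  have := isManifold_one (E := E) (M := M)
  have htangent := ((contMDiffOn_symm_of_mem_maximalAtlas hφ).mono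
    hUφ).contMDiffOn_tangentMapWithin (m := ∞) (by norm_cast) hU.uniqueMDiffOn
  have hsection := (contMDiffOn_vectorSpace_iff_contDiffOn.2 hW).comp
    ((contMDiffOn_of_mem_maximalAtlas hφ).mono (Set.inter_subset_left (t := φ ⁻¹' U)))
    fun y hy ↦ hy.2
  refine (htangent.comp hsection fun y hy ↦ hy.2).congr fun y hy ↦ ?_
  simp only [Function.comp_def, tangentMapWithin, vFieldOfRep, mfderivWithin_of_isOpen hU hy.2]
  congr 1
  exact (φ.left_inv hy.1).symm

theorem differentiableAt_vFieldRep {X : VField E M} {U : Set M} {x : M} (hX : SmoothVFieldOn X U)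
    (hU : U ∈ 𝓝 x) : DifferentiableAt ℝ (vFieldRep (chartAt E x) X) (chartAt E x x) := by
  refine ((contDiffOn_vFieldRep (IsManifold.chart_mem_maximalAtlas x) hX).contDiffAt
    (Filter.inter_mem ((chartAt E x).open_target.mem_nhds (mem_chart_target E x)) ?_)
    ).differentiableAt (by norm_cast)
  refine ((chartAt E x).continuousAt_symm (mem_chart_target E x)).preimage_mem_nhds ?_
  rwa [(chartAt E x).left_inv (mem_chart_source E x)]

end ChartRepresentation

section InvariantSubmanifold

variable {E : Type*} [NormedAddCommGroup E] [NormedSpace ℝ E]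
  {M : Type*} [TopologicalSpace M] [ChartedSpace E M]

theorem mfderiv_mem_of_isTangentAt {F : Type*} [NormedAddCommGroup F] [NormedSpace ℝ F] {f : M → F}
    {S : Set M} {x : M} {a : F} {P : Submodule ℝ F} (hPc : IsClosed (P : Set F))
    (hf : MDifferentiableAt 𝓘(ℝ, E) 𝓘(ℝ, F) f x) (hP : ∀ᶠ y in 𝓝 x, y ∈ S → f y - a ∈ P)
    {w : TangentSpace 𝓘(ℝ, E) x} (hw : IsTangentAt S x w) :
    (mfderiv 𝓘(ℝ, E) 𝓘(ℝ, F) f x w : F) ∈ P := by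
  obtain ⟨c, rfl, hc, hcS, hcd⟩ := hw
  let L : E →L[ℝ] F := mfderiv 𝓘(ℝ, E) 𝓘(ℝ, F) f (c 0)
  have hfderiv : HasFDerivAt (f ∘ c) (L ∘L (1 : ℝ →L[ℝ] ℝ).smulRight (show E from w)) 0 :=
    (hf.hasMFDerivAt.comp 0 hcd).hasFDerivAt
  have hderiv : HasDerivAt (f ∘ c) (L w) 0 :=
    hfderiv.hasDerivAt.congr_deriv (congrArg L (one_smul ℝ (show E from w)))
  have hcP : ∀ᶠ t in 𝓝 (0 : ℝ), f (c t) - a ∈ P := by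
    filter_upwards [hc.continuousAt.eventually hP, hcS] with t htP htS using htP htS
  refine hPc.mem_of_tendsto (hasDerivAt_iff_tendsto_slope.1 hderiv) ?_
  filter_upwards [nhdsWithin_le_nhds hcP] with t ht
  rw [slope_def_module]
  exact P.smul_mem _ (by simpa using P.sub_mem ht hcP.self_of_nhds)

theorem hasDerivWithinAt_comp_of_isSolutionOn {X : ℝ → VField E M} {γ : ℝ → M} {s : Set ℝ}
    (hγ : IsSolutionOn X γ s) {t : ℝ} (ht : t ∈ s) {φ : OpenPartialHomeomorph M E}
    (hφ : φ.MDifferentiable 𝓘(ℝ, E) 𝓘(ℝ, E)) (hφt : γ t ∈ φ.source) :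
    HasDerivWithinAt (φ ∘ γ) (vFieldRep φ (X t) (φ (γ t))) s t := by
  let L : E →L[ℝ] E := mfderiv 𝓘(ℝ, E) 𝓘(ℝ, E) φ (γ t)
  have hfderiv :
      HasFDerivWithinAt (φ ∘ γ) (L ∘L (1 : ℝ →L[ℝ] ℝ).smulRight (show E from X t (γ t))) s t :=
    ((hφ.mdifferentiableAt hφt).hasMFDerivAt.comp_hasMFDerivWithinAt t (hγ t ht)).hasFDerivWithinAt
  unfold vFieldRep
  rw [φ.left_inv hφt]
  exact hfderiv.hasDerivWithinAt.congr_deriv (congrArg L (one_smul ℝ (show E from X t (γ t))))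

theorem vFieldRep_sum_smul {ι : Type*} [Fintype ι] (φ : OpenPartialHomeomorph M E) (b : ι → ℝ)
    (Xs : ι → VField E M) (u : E) :
    vFieldRep φ (fun x ↦ ∑ α, b α • Xs α x) u = ∑ α, b α • vFieldRep φ (Xs α) u := by
  unfold vFieldRep
  rw [map_sum]
  exact Finset.sum_congr rfl fun α _ ↦ map_smul _ _ _

theorem mapsTo_of_isPreconnected_of_eventually_mem {T Y : Type*} [TopologicalSpace T]
    [TopologicalSpace Y] {s : Set T} {S : Set Y} {γ : T → Y} (hs : IsPreconnected s)
    (hγ : ContinuousOn γ s) (hS : IsClosed S)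
    (hstay : ∀ t ∈ s, γ t ∈ S → ∀ᶠ τ in 𝓝[s] t, γ τ ∈ S) {t₀ : T} (ht₀ : t₀ ∈ s)
    (hγ₀ : γ t₀ ∈ S) : Set.MapsTo γ s S := by
  have : PreconnectedSpace s := Subtype.preconnectedSpace hs
  have hclosed : IsClosed {τ : s | γ τ ∈ S} := hS.preimage hγ.domRestrict
  have hopen : IsOpen {τ : s | γ τ ∈ S} := isOpen_iff_mem_nhds.2 fun τ hτ ↦ by
    rw [nhds_subtype_eq_comap_nhdsWithin]
    exact Filter.preimage_mem_comap (hstay τ τ.2 hτ)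
  have huniv := IsClopen.eq_univ ⟨hclosed, hopen⟩ ⟨⟨t₀, ht₀⟩, hγ₀⟩
  exact fun t ht ↦ huniv.ge (Set.mem_univ (⟨t, ht⟩ : s))

variable [IsManifold 𝓘(ℝ, E) ∞ M] [FiniteDimensional ℝ E] {ι : Type*} [Fintype ι]
  {Xs : ι → VField E M} {b : ι → ℝ → ℝ} {S : Set M}

theorem eventually_mem_of_isTangentAt (hsmooth : ∀ α, SmoothVField (Xs α))
    (hb : ∀ α, Continuous (b α)) (hsub : IsEmbeddedSubmanifold E S)
    (htan : ∀ α, ∀ x ∈ S, IsTangentAt S x (Xs α x)) {s : Set ℝ} {γ : ℝ → M} (hs : s.OrdConnected)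
    (hγ : IsSolutionOn (fun t x ↦ ∑ α, b α t • Xs α x) γ s) {t₀ : ℝ} (ht₀ : t₀ ∈ s)
    (hγ₀ : γ t₀ ∈ S) : ∀ᶠ t in 𝓝[s] t₀, γ t ∈ S := by
  obtain ⟨φ, hφ, hxφ, P, hP⟩ := hsub (γ t₀) hγ₀
  have hφd := mdifferentiable_of_mem_maximalAtlas hφ
  have hφT : φ.target ∈ 𝓝 (φ (γ t₀)) := φ.open_target.mem_nhds (φ.map_source hxφ)
  have hrep : ∀ α, ContDiffAt ℝ 1 (vFieldRep φ (Xs α)) (φ (γ t₀)) := fun α ↦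
    ((contDiffOn_vFieldRep hφ (hsmooth α).contMDiffOn (U := Set.univ)).contDiffAt
      (by simpa using hφT)).of_le (by norm_cast)
  have hrepP : ∀ u ∈ φ.target, u - φ (γ t₀) ∈ P → ∀ α, vFieldRep φ (Xs α) u ∈ P := by
    intro u hu huP α
    have hyφ := φ.map_target hu
    have hyS : φ.symm u ∈ S := (hP _ hyφ).2 (by rwa [φ.right_inv hu])
    exact mfderiv_mem_of_isTangentAt P.closed_of_finiteDimensional (hφd.mdifferentiableAt hyφ)
      ((φ.open_source.eventually_mem hyφ).mono fun z hz ↦ (hP z hz).1) (htan α _ hyS)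
  obtain ⟨K, T, hT, hLip⟩ :=
    exists_eventually_lipschitzOnWith_sum_smul hrep fun α ↦ (hb α).continuousAt (x := t₀)
  have hγφ : ∀ᶠ t in 𝓝[s] t₀, γ t ∈ φ.source :=
    (hγ t₀ ht₀).continuousWithinAt (φ.open_source.mem_nhds hxφ)
  have hslice : ∀ᶠ t in 𝓝[s] t₀, φ (γ t) - φ (γ t₀) ∈ P := by
    refine eventually_sub_mem_of_lipschitzOnWith
      (V := fun t u ↦ ∑ α, b α t • vFieldRep φ (Xs α) u) (c := φ ∘ γ)
      (Submodule.ClosedComplemented.of_finiteDimensional P) (Filter.inter_mem hT hφT)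
      (nhdsWithin_le_nhds (hLip.mono fun t ht ↦ ht.mono Set.inter_subset_left))
      (fun u hu huP t ↦ P.sum_mem fun α _ ↦ P.smul_mem _ (hrepP u hu.2 huP α)) hs ht₀ ?_
    filter_upwards [hγφ, self_mem_nhdsWithin] with t htφ hts
    exact (hasDerivWithinAt_comp_of_isSolutionOn hγ hts hφd htφ).congr_deriv
      (vFieldRep_sum_smul φ (fun α ↦ b α t) Xs (φ (γ t)))
  filter_upwards [hslice, hγφ] with t htP htφ using (hP _ htφ).2 htP

theorem isInvariantUnder_of_isTangentAt (hsmooth : ∀ α, SmoothVField (Xs α))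
    (hb : ∀ α, Continuous (b α)) (hS : IsClosed S) (hsub : IsEmbeddedSubmanifold E S)
    (htan : ∀ α, ∀ x ∈ S, IsTangentAt S x (Xs α x)) :
    IsInvariantUnder (fun t x ↦ ∑ α, b α t • Xs α x) S := fun _ _ hs hγ _ ht₀ hγ₀ ↦
  mapsTo_of_isPreconnected_of_eventually_mem hs.isPreconnected
    (fun t ht ↦ (hγ t ht).continuousWithinAt) hS
    (fun _ ht ↦ eventually_mem_of_isTangentAt hsmooth hb hsub htan hs hγ ht) ht₀ hγ₀

end InvariantSubmanifold

section OneForm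

variable {E : Type*} [NormedAddCommGroup E] [NormedSpace ℝ E]
  {M : Type*} [TopologicalSpace M] [ChartedSpace E M]
  {F : Type*} [NormedAddCommGroup F] [NormedSpace ℝ F]

/-- The contraction (interior product) `ι_X η` of the one-form `η` with the vector field `X`. -/
noncomputable def contraction (η : OneForm E M F) (X : VField E M) (x : M) : F := η x (X x)

/-- The differential `df` of the function `f`, as a one-form: the derivative `mfderiv` of `f`, with
the tangent spaces of the vector space `F` identified with `F`. -/
noncomputable def differential (f : M → F) : OneForm E M F := fun x ↦
  mfderiv 𝓘(ℝ, E) 𝓘(ℝ, F) f x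

variable [IsManifold 𝓘(ℝ, E) ∞ M]

theorem mfderiv_chartAt_symm_self (x : M) :
    mfderiv 𝓘(ℝ, E) 𝓘(ℝ, E) (chartAt E x).symm (chartAt E x x) = .id ℝ E := by
  have := isManifold_one (E := E) (M := M)
  simpa using! mfderivWithin_range_extChartAt_symm (I := 𝓘(ℝ, E)) (x := x)

theorem mfderiv_chartAt_self (x : M) :
    mfderiv 𝓘(ℝ, E) 𝓘(ℝ, E) (chartAt E x) x = .id ℝ E := by
  have := isManifold_one (E := E) (M := M)
  exact mfderiv_extChartAt_self (I := 𝓘(ℝ, E)) (x := x)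

theorem vFieldRep_chartAt_self (X : VField E M) (x : M) :
    vFieldRep (chartAt E x) X (chartAt E x x) = X x := by
  unfold vFieldRep
  rw [(chartAt E x).left_inv (mem_chart_source E x), mfderiv_chartAt_self]
  rfl

theorem chartRep_self (η : OneForm E M F) (x : M) : chartRep η x (chartAt E x x) = η x := by
  have h := mfderiv_chartAt_symm_self (E := E) x
  unfold chartRep
  simp only [mfld_simps]
  rw [h, (chartAt E x).left_inv (mem_chart_source E x)]
  rfl

theorem chartRep_vFieldRep (η : OneForm E M F) (X : VField E M) {x₀ : M} {u : E}
    (hu : u ∈ (chartAt E x₀).target) :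
    chartRep η x₀ u (vFieldRep (chartAt E x₀) X u) = contraction η X ((chartAt E x₀).symm u) := by
  have h := (mdifferentiable_of_mem_maximalAtlas (IsManifold.chart_mem_maximalAtlas
    (I := 𝓘(ℝ, E)) (n := ∞) x₀)).symm_comp_deriv ((chartAt E x₀).map_target hu)
  rw [(chartAt E x₀).right_inv hu] at h
  exact congrArg (fun L : E →L[ℝ] E ↦ η ((chartAt E x₀).symm u) (L (X ((chartAt E x₀).symm u)))) h

theorem extD_apply (η : OneForm E M F) (x : M) (v w : TangentSpace 𝓘(ℝ, E) x) :
    extD η x v w = fderiv ℝ (chartRep η x) (chartAt E x x) v w -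
      fderiv ℝ (chartRep η x) (chartAt E x x) w v := by
  have := isManifold_one (E := E) (M := M)
  unfold extD
  rw [mfderiv_extChartAt_self]
  rfl

theorem extD_swap (η : OneForm E M F) (x : M) (v w : TangentSpace 𝓘(ℝ, E) x) :
    extD η x v w = -extD η x w v := by
  rw [extD_apply, extD_apply, neg_sub]

theorem mlieBracket_eq_fderiv_vFieldRep (X Y : VField E M) (x : M) :
    VectorField.mlieBracket 𝓘(ℝ, E) X Y x =
      fderiv ℝ (vFieldRep (chartAt E x) Y) (chartAt E x x) (X x) -
        fderiv ℝ (vFieldRep (chartAt E x) X) (chartAt E x x) (Y x) := by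
  have := isManifold_one (E := E) (M := M)
  have hrep : ∀ Z : VField E M, VectorField.mpullbackWithin 𝓘(ℝ, E) 𝓘(ℝ, E)
      (extChartAt 𝓘(ℝ, E) x).symm Z (Set.range 𝓘(ℝ, E)) =ᶠ[𝓝 (chartAt E x x)]
        vFieldRep (chartAt E x) Z := fun Z ↦ by
    filter_upwards [extChartAt_target_mem_nhds (I := 𝓘(ℝ, E)) x] with u hu
    rw [VectorField.mpullbackWithin_apply, ContinuousLinearMap.inverse_eq
      (mfderivWithin_extChartAt_symm_comp_mfderiv_extChartAt hu)
      (mfderiv_extChartAt_comp_mfderivWithin_extChartAt_symm hu)]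
    rfl
  rw [← VectorField.mlieBracketWithin_univ, VectorField.mlieBracketWithin_apply]
  refine (congrArg (fun L : E →L[ℝ] E ↦ L.inverse _) (mfderiv_chartAt_self x)).trans ?_
  rw [ContinuousLinearMap.inverse_id, ContinuousLinearMap.id_apply, modelWithCornersSelf_coe,
    Set.range_id, Set.preimage_univ, Set.inter_univ]
  refine (congrFun VectorField.lieBracketWithin_univ _).trans ?_
  rw [modelWithCornersSelf_coe, Set.range_id] at hrep
  refine ((hrep X).lieBracket_vectorField_eq (hrep Y)).trans ?_
  rw [VectorField.lieBracket, vFieldRep_chartAt_self, vFieldRep_chartAt_self]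

theorem contMDiffOn_contraction {η : OneForm E M F} (hη : SmoothOneForm η) {X : VField E M}
    {U : Set M} (hX : SmoothVFieldOn X U) :
    ContMDiffOn 𝓘(ℝ, E) 𝓘(ℝ, F) ∞ (contraction η X) U := by
  have := isManifold_one (E := E) (M := M)
  intro x hx
  have h := ContMDiffWithinAt.clm_bundle_apply (E₂ := Bundle.Trivial M F) (b := id) (ϕ := η)
    (hη.contMDiffOn (s := U) x hx) (hX x hx)
  exact ((Bundle.contMDiffWithinAt_totalSpace ..).1 h).2

variable [FiniteDimensional ℝ E] {η : OneForm E M F}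

theorem contDiffOn_chartRep (hη : SmoothOneForm η) (x₀ : M) :
    ContDiffOn ℝ ∞ (chartRep η x₀) (chartAt E x₀).target := by
  have hφ := IsManifold.chart_mem_maximalAtlas (I := 𝓘(ℝ, E)) (n := ∞) x₀
  refine contDiffOn_clm_apply.2 fun w ↦ ?_
  have hcontr := contMDiffOn_contraction hη (smoothVFieldOn_vFieldOfRep hφ
    (chartAt E x₀).open_target subset_rfl (contDiffOn_const (c := w)))
  refine (contMDiffOn_iff_contDiffOn.1 (hcontr.comp (contMDiffOn_symm_of_mem_maximalAtlas hφ)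
    fun u hu ↦ ⟨(chartAt E x₀).map_target hu, ?_⟩)).congr fun u hu ↦ ?_
  · simpa [(chartAt E x₀).right_inv hu] using hu
  · rw [Function.comp_apply, ← chartRep_vFieldRep η _ hu, vFieldRep_vFieldOfRep hφ _ hu]

theorem differentiableAt_chartRep (hη : SmoothOneForm η) (x : M) :
    DifferentiableAt ℝ (chartRep η x) (chartAt E x x) :=
  ((contDiffOn_chartRep hη x).contDiffAt
    ((chartAt E x).open_target.mem_nhds (mem_chart_target E x))).differentiableAt (by norm_cast)

theorem differential_contraction_apply (hη : SmoothOneForm η) {X : VField E M} {U : Set M} {x : M}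
    (hX : SmoothVFieldOn X U) (hU : U ∈ 𝓝 x) (v : TangentSpace 𝓘(ℝ, E) x) :
    differential (contraction η X) x v =
      fderiv ℝ (chartRep η x) (chartAt E x x) v (X x) +
        η x (fderiv ℝ (vFieldRep (chartAt E x) X) (chartAt E x x) v) := by
  have hrep := (differentiableAt_chartRep hη x).hasFDerivAt.clm_apply
    (differentiableAt_vFieldRep hX hU).hasFDerivAt
  have hchart := ((mdifferentiable_of_mem_maximalAtlas (IsManifold.chart_mem_maximalAtlas
    (I := 𝓘(ℝ, E)) (n := ∞) x)).mdifferentiableAt (mem_chart_source E x)).hasMFDerivAt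
  rw [mfderiv_chartAt_self] at hchart
  have hcomp := (hrep.hasMFDerivAt.comp x hchart).congr_of_eventuallyEq
    (f₁ := contraction η X) <| by
      filter_upwards [(chartAt E x).open_source.mem_nhds (mem_chart_source E x)] with y hy
      rw [Function.comp_apply, chartRep_vFieldRep η X ((chartAt E x).map_source hy),
        (chartAt E x).left_inv hy]
  rw [differential, hcomp.mfderiv, ← vFieldRep_chartAt_self X x, ← chartRep_self η x]
  exact add_comm _ _

theorem extD_apply_vField (hη : SmoothOneForm η) {X Y : VField E M} {U : Set M} {x : M}
    (hX : SmoothVFieldOn X U) (hY : SmoothVFieldOn Y U) (hU : U ∈ 𝓝 x) :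
    extD η x (X x) (Y x) = differential (contraction η Y) x (X x) -
      differential (contraction η X) x (Y x) -
        η x (VectorField.mlieBracket 𝓘(ℝ, E) X Y x) := by
  have hsub : ∀ a b : E, η x (a - b : E) = η x a - η x b := fun a b ↦ map_sub (η x) a b
  rw [differential_contraction_apply hη hX hU, differential_contraction_apply hη hY hU,
    mlieBracket_eq_fderiv_vFieldRep, extD_apply, hsub]
  abel

end OneForm

section LieSymmetry

variable {E : Type*} [NormedAddCommGroup E] [NormedSpace ℝ E]
  {F : Type*} [NormedAddCommGroup F] [NormedSpace ℝ F]

/- With `K` a right inverse of `e u₀`, the constant field `w` is corrected by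
`K ((e u ∘ K)⁻¹ (e u w))`, which makes sense where `e u ∘ K` is invertible. -/
theorem exists_contDiffOn_mem_ker [FiniteDimensional ℝ F] {e : E → E →L[ℝ] F} {T : Set E}
    (hT : IsOpen T) (he : ContDiffOn ℝ ∞ e T) {u₀ : E} (hu₀ : u₀ ∈ T)
    (hsurj : Function.Surjective (e u₀)) {w : E} (hw : e u₀ w = 0) :
    ∃ (U : Set E) (W : E → E), IsOpen U ∧ U ⊆ T ∧ u₀ ∈ U ∧ ContDiffOn ℝ ∞ W U ∧
      W u₀ = w ∧ ∀ u ∈ U, e u (W u) = 0 := by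
  obtain ⟨K, hK⟩ := (e u₀).exists_rightInverse_of_surjective (LinearMap.range_eq_top.2 hsurj)
  have heK : ContDiffOn ℝ ∞ (fun u ↦ e u ∘L K) T := he.clm_comp contDiffOn_const
  refine ⟨T ∩ (fun u ↦ e u ∘L K) ⁻¹' Set.range ((↑) : (F ≃L[ℝ] F) → F →L[ℝ] F),
    fun u ↦ w - K ((e u ∘L K).inverse (e u w)),
    heK.continuousOn.isOpen_inter_preimage hT ContinuousLinearEquiv.isOpen,
    Set.inter_subset_left, ⟨hu₀, ContinuousLinearEquiv.refl ℝ F, hK.symm⟩,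
    fun u hu ↦ ?_, by simp [hw], fun u hu ↦ ?_⟩
  · have hinv : ContDiffWithinAt ℝ ∞ (fun u ↦ (e u ∘L K).inverse) T u :=
      ContDiffAt.comp_contDiffWithinAt u (g := ContinuousLinearMap.inverse)
        (ContinuousLinearMap.IsInvertible.contDiffAt_map_inverse hu.2) (heK u hu.1)
    exact (contDiffWithinAt_const.sub (K.contDiff.comp_contDiffWithinAt
      (hinv.clm_apply ((he u hu.1).clm_apply contDiffWithinAt_const)))).mono Set.inter_subset_left
  · have hinv : e u (K ((e u ∘L K).inverse (e u w))) = e u w :=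
      congrArg (fun L ↦ L (e u w)) (ContinuousLinearMap.IsInvertible.self_comp_inverse hu.2)
    rw [map_sub, hinv, sub_self]

variable [FiniteDimensional ℝ E] [FiniteDimensional ℝ F]
  {M : Type*} [TopologicalSpace M] [ChartedSpace E M] [IsManifold 𝓘(ℝ, E) ∞ M]
  {η : OneForm E M F} {x : M}

theorem exists_smoothVFieldOn_contraction_eq_zero (hη : SmoothOneForm η)
    (hsurj : Function.Surjective (η x)) {w : TangentSpace 𝓘(ℝ, E) x} (hw : η x w = 0) :
    ∃ (U : Set M) (Y : VField E M), IsOpen U ∧ x ∈ U ∧ SmoothVFieldOn Y U ∧ Y x = w ∧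
      ∀ y ∈ U, contraction η Y y = 0 := by
  have hφ := IsManifold.chart_mem_maximalAtlas (I := 𝓘(ℝ, E)) (n := ∞) x
  obtain ⟨U, W, hU, hUt, hxU, hW, hWx, hker⟩ := exists_contDiffOn_mem_ker
    (chartAt E x).open_target (contDiffOn_chartRep hη x) (mem_chart_target E x)
    (by rwa [chartRep_self]) (w := w) (by rwa [chartRep_self])
  refine ⟨(chartAt E x).source ∩ chartAt E x ⁻¹' U, vFieldOfRep (chartAt E x) W,
    (chartAt E x).continuousOn.isOpen_inter_preimage (chartAt E x).open_source hU,
    ⟨mem_chart_source E x, hxU⟩, smoothVFieldOn_vFieldOfRep hφ hU hUt hW, ?_, fun y hy ↦ ?_⟩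
  · rw [← vFieldRep_chartAt_self (vFieldOfRep _ W), vFieldRep_vFieldOfRep hφ W (hUt hxU), hWx]
  · have h := chartRep_vFieldRep η (vFieldOfRep (chartAt E x) W) (hUt hy.2)
    rw [vFieldRep_vFieldOfRep hφ W (hUt hy.2), hker _ hy.2, (chartAt E x).left_inv hy.1] at h
    exact h.symm

theorem extD_apply_of_isLieSymmetryKer (hη : SmoothOneForm η) (hsurj : Function.Surjective (η x))
    {X : VField E M} (hX : SmoothVField X) (hsymm : IsLieSymmetryKer η X)
    {w : TangentSpace 𝓘(ℝ, E) x} (hw : η x w = 0) :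
    extD η x (X x) w = -differential (contraction η X) x w := by
  obtain ⟨U, Y, hU, hxU, hY, rfl, hker⟩ := exists_smoothVFieldOn_contraction_eq_zero hη hsurj hw
  have hYη : HasMFDerivAt 𝓘(ℝ, E) 𝓘(ℝ, F) (contraction η Y) x 0 :=
    (hasMFDerivAt_const (0 : F) x).congr_of_eventuallyEq ((hU.eventually_mem hxU).mono hker)
  have hdY : differential (contraction η Y) x = 0 := hYη.mfderiv
  rw [extD_apply_vField hη hX.contMDiffOn hY (hU.mem_nhds hxU), hsymm U Y hU hY hker x hxU, hdY]
  simp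

theorem differential_contraction_apply_of_isLieSymmetryKer (hη : SmoothOneForm η)
    (hsurj : Function.Surjective (η x)) {X Y : VField E M} (hX : SmoothVField X)
    (hY : SmoothVField Y) (hsymm : IsLieSymmetryKer η X) {R : TangentSpace 𝓘(ℝ, E) x}
    (hR : η x R = -η x (Y x)) (hdR : extD η x R = 0) :
    differential (contraction η Y) x (X x) = η x (VectorField.mlieBracket 𝓘(ℝ, E) X Y x) -
      differential (contraction η X) x R := by
  have hker : extD η x (X x) (Y x + R) = -differential (contraction η X) x (Y x + R) :=
    extD_apply_of_isLieSymmetryKer hη hsurj hX hsymm (by rw [map_add, hR, add_neg_cancel])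
  have hXR : extD η x (X x) R = 0 := by rw [extD_swap, hdR]; simp
  rw [map_add, map_add, hXR, extD_apply_vField hη hX.contMDiffOn hY.contMDiffOn
    Filter.univ_mem] at hker
  rw [← sub_eq_zero] at hker ⊢
  rw [← hker]
  abel

end LieSymmetry

section MomentumMap

variable {M : Type*} {𝔤 : Type*} [LieRing 𝔤] [LieAlgebra ℝ 𝔤] {r k : ℕ}
  (v : Module.Basis (Fin r) ℝ (Module.Dual ℝ 𝔤)) {h : Fin r → M → Fin k → ℝ}
  {θ : Module.Dual ℝ (Fin k → ℝ)} {x : M}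

theorem momentumMapAlong_eq_sum : momentumMapAlong v h θ x = ∑ α, θ (h α x) • v α := by
  simp [momentumMapAlong, momentumMap, map_sum]

theorem mem_zeroLevel_iff : x ∈ zeroLevel v h θ ↔ ∀ α, θ (h α x) = 0 := by
  rw [zeroLevel, Set.mem_ofPred_eq, momentumMapAlong_eq_sum]
  exact ⟨Fintype.linearIndependent_iff.1 v.linearIndependent _, fun hx ↦ by simp [hx]⟩

variable {E : Type*} [NormedAddCommGroup E] [NormedSpace ℝ E]
  [TopologicalSpace M] [ChartedSpace E M]

theorem mfderiv_momentumMapAlong_apply (hθ : ∀ α, MDifferentiableAt 𝓘(ℝ, E) 𝓘(ℝ, ℝ) (θ ∘ h α) x)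
    (a : 𝔤) (w : TangentSpace 𝓘(ℝ, E) x) :
    mfderiv 𝓘(ℝ, E) 𝓘(ℝ, ℝ) (fun y ↦ momentumMapAlong v h θ y a) x w =
      ∑ α, v α a * differential (θ ∘ h α) x w := by
  have hJ : (fun y ↦ momentumMapAlong v h θ y a) = ∑ α, v α a • (θ ∘ h α) := by
    funext y
    simp [momentumMapAlong_eq_sum, mul_comm]
  let D : Fin r → E →L[ℝ] ℝ := fun α ↦ differential (θ ∘ h α) x
  have hderiv : HasMFDerivAt 𝓘(ℝ, E) 𝓘(ℝ, ℝ) (∑ α, v α a • (θ ∘ h α)) x (∑ α, v α a • D α) :=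
    HasMFDerivAt.sum fun α _ ↦ (hθ α).hasMFDerivAt.const_smul (v α a)
  have heval : ∀ u : E, (∑ α, v α a • D α) u = ∑ α, v α a * D α u := fun u ↦ by simp
  rw [hJ, hderiv.mfderiv]
  exact heval w

end MomentumMap

section ReebDerivation

variable {E : Type*} [NormedAddCommGroup E] [NormedSpace ℝ E] [FiniteDimensional ℝ E]
  {M : Type*} [TopologicalSpace M] [ChartedSpace E M] [IsManifold 𝓘(ℝ, E) ∞ M]
  {k : ℕ} {η : OneForm E M (Fin k → ℝ)}

theorem apply_reebDerivation (hη : IsKContactForm η) (h : M → Fin k → ℝ) (x : M) :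
    η x (reebDerivation η h x) = h x := by
  rw [reebDerivation, map_sum]
  simp_rw [map_smul, (reeb_spec hη _ x).1]
  exact (pi_eq_sum_univ' (h x)).symm

theorem extD_reebDerivation (hη : IsKContactForm η) (h : M → Fin k → ℝ) (x : M) :
    extD η x (reebDerivation η h x) = 0 := by
  rw [reebDerivation, map_sum]
  simp_rw [map_smul, (reeb_spec hη _ x).2, smul_zero, Finset.sum_const_zero]

theorem IsKContactForm.surjective (hη : IsKContactForm η) (x : M) :
    Function.Surjective (η x) := fun a ↦
  ⟨reebDerivation η (fun _ ↦ a) x, apply_reebDerivation hη _ x⟩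

end ReebDerivation

section HamiltonianFunction

variable {E : Type*} [NormedAddCommGroup E] [NormedSpace ℝ E]
  {M : Type*} [TopologicalSpace M] [ChartedSpace E M]
  {F : Type*} [NormedAddCommGroup F] [NormedSpace ℝ F]
  {G : Type*} [NormedAddCommGroup G] [NormedSpace ℝ G] {η : OneForm E M F}

theorem apply_eq_zero_of_mem_span {ι : Type*} {Xs : ι → VField E M} {Z : VField E M}
    (hZ : Z ∈ Submodule.span ℝ (Set.range Xs)) (θ : F →L[ℝ] G) {x : M}
    (hx : ∀ α, θ (η x (Xs α x)) = 0) : θ (η x (Z x)) = 0 := by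
  let ev : VField E M →ₗ[ℝ] G :=
    θ.toLinearMap ∘ₗ (η x).toLinearMap ∘ₗ LinearMap.proj (R := ℝ) x
  have hspan : Submodule.span ℝ (Set.range Xs) ≤ ev.ker :=
    Submodule.span_le.2 (Set.range_subset_iff.2 hx)
  exact hspan hZ

variable [IsManifold 𝓘(ℝ, E) ∞ M] {X Y : VField E M} {f g : M → F}

theorem hasMFDerivAt_comp_hamiltonian (hη : SmoothOneForm η) (hX : SmoothVField X)
    (hf : ∀ x, f x = -η x (X x)) (θ : F →L[ℝ] G) (x : M) :
    HasMFDerivAt 𝓘(ℝ, E) 𝓘(ℝ, G) (θ ∘ f) x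
      (-(θ ∘L (show E →L[ℝ] F from differential (contraction η X) x))) := by
  have hd : MDifferentiableAt 𝓘(ℝ, E) 𝓘(ℝ, F) (contraction η X) x :=
    (contMDiffOn_univ.1 (contMDiffOn_contraction hη hX.contMDiffOn)).mdifferentiableAt
      (by norm_cast)
  have hθf : θ ∘ f = (-θ) ∘ contraction η X := by
    funext y
    simp [hf, contraction]
  rw [hθf]
  exact (-θ).hasMFDerivAt.comp x hd.hasMFDerivAt

theorem differential_comp_hamiltonian_apply (hη : SmoothOneForm η) (hX : SmoothVField X)
    (hf : ∀ x, f x = -η x (X x)) (θ : F →L[ℝ] G) (x : M) (w : TangentSpace 𝓘(ℝ, E) x) :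
    differential (θ ∘ f) x w = -θ (differential (contraction η X) x w) :=
  congrArg (fun L : E →L[ℝ] G ↦ L w) (hasMFDerivAt_comp_hamiltonian hη hX hf θ x).mfderiv

theorem differential_comp_hamiltonian_apply_eq_zero [FiniteDimensional ℝ E] [FiniteDimensional ℝ F]
    (hη : SmoothOneForm η) (hX : SmoothVField X) (hY : SmoothVField Y)
    (hsymm : IsLieSymmetryKer η X) (hf : ∀ x, f x = -η x (X x)) (hg : ∀ x, g x = -η x (Y x))
    {θ : F →L[ℝ] G} {x : M} (hsurj : Function.Surjective (η x))
    (hbracket : θ (η x (VectorField.mlieBracket 𝓘(ℝ, E) X Y x)) = 0)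
    {R : TangentSpace 𝓘(ℝ, E) x} (hR : η x R = g x) (hdR : extD η x R = 0)
    (hfR : differential (θ ∘ f) x R = 0) : differential (θ ∘ g) x (X x) = 0 := by
  rw [differential_comp_hamiltonian_apply hη hX hf] at hfR
  rw [differential_comp_hamiltonian_apply hη hY hg,
    differential_contraction_apply_of_isLieSymmetryKer hη hsurj hX hY hsymm (hR.trans (hg x)) hdR,
    map_sub, hbracket, zero_sub, neg_neg]
  exact neg_eq_zero.1 hfR

end HamiltonianFunction

end KContact

open KContact in
theorem mainTheorem7_general
    {E : Type*} [NormedAddCommGroup E] [NormedSpace ℝ E] [FiniteDimensional ℝ E]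
    {M : Type*} [TopologicalSpace M] [ChartedSpace E M] [IsManifold 𝓘(ℝ, E) ∞ M]
    {F : Type*} [NormedAddCommGroup F] [NormedSpace ℝ F] [FiniteDimensional ℝ F]
    {G : Type*} [NormedAddCommGroup G] [NormedSpace ℝ G] {r : ℕ}
    (η : OneForm E M F) (hη : SmoothOneForm η)
    (X : ℝ → VField E M) (Xs : Fin r → VField E M) (hX : IsLieSystemWith X Xs)
    (hXs : ∀ α, IsLieSymmetryKer η (Xs α))
    (h : Fin r → M → F) (hh : ∀ α x, h α x = -η x (Xs α x))
    (θ : F →L[ℝ] G) (S : Set M) (hS : ∀ x, x ∈ S ↔ ∀ α, θ (h α x) = 0)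
    (hsurj : ∀ x ∈ S, Function.Surjective (η x))
    (hsub : IsEmbeddedSubmanifold E S)
    (hreg : ∀ x ∈ S, ∀ w : TangentSpace 𝓘(ℝ, E) x,
      (∀ α, differential (θ ∘ h α) x w = 0) → IsTangentAt S x w)
    (htan : ∀ α, ∀ x ∈ S, ∃ R : TangentSpace 𝓘(ℝ, E) x,
      η x R = h α x ∧ extD η x R = 0 ∧ IsTangentAt S x R) :
    IsInvariantUnder X S := by
  obtain ⟨b, hb, hXb⟩ := hX.decomposition
  obtain rfl : X = fun t x ↦ ∑ α, b α t • Xs α x := funext fun t ↦ funext fun x ↦ hXb t x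
  have hθh : ∀ α, MDifferentiable 𝓘(ℝ, E) 𝓘(ℝ, G) (θ ∘ h α) := fun α x ↦
    (hasMFDerivAt_comp_hamiltonian hη (hX.smooth α) (hh α) θ x).mdifferentiableAt
  have hclosed : IsClosed S := by
    have hSeq : S = ⋂ α, (θ ∘ h α) ⁻¹' {0} := by ext x; simp [hS]
    exact hSeq ▸ isClosed_iInter fun α ↦ isClosed_singleton.preimage (hθh α).continuous
  refine isInvariantUnder_of_isTangentAt hX.smooth hb hclosed hsub fun α x hx ↦
    hreg x hx _ fun β ↦ ?_
  obtain ⟨R, hR, hdR, hRS⟩ := htan β x hx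
  have hαR : differential (θ ∘ h α) x R = 0 := mfderiv_mem_of_isTangentAt (a := 0) (P := ⊥)
    isClosed_singleton (hθh α x) (.of_forall fun y hy ↦ by simpa using (hS y).1 hy α) hRS
  have hbracket : θ (η x (VectorField.mlieBracket 𝓘(ℝ, E) (Xs α) (Xs β) x)) = 0 :=
    apply_eq_zero_of_mem_span (hX.bracket_mem α β) θ fun γ ↦ by
      simpa [hh] using (hS x).1 hx γ
  exact differential_comp_hamiltonian_apply_eq_zero hη (hX.smooth α) (hX.smooth β) (hXs α)
    (hh α) (hh β) (hsurj x hx) hbracket hR hdR hαR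

open KContact in
theorem mainTheorem7
    {E : Type*} [NormedAddCommGroup E] [NormedSpace ℝ E] [FiniteDimensional ℝ E]
    {M : Type*} [TopologicalSpace M] [T2Space M] [ChartedSpace E M] [IsManifold 𝓘(ℝ, E) ∞ M]
    {k r : ℕ}
    (η : OneForm E M (Fin k → ℝ)) (hη : IsKContactForm η)
    (X : ℝ → VField E M) (Xs : Fin r → VField E M) (hX : IsLieSystemWith X Xs)
    (h : Fin r → M → Fin k → ℝ) (hXs : ∀ α, IsHamiltonian η (Xs α) (h α))
    {𝔤 : Type*} [LieRing 𝔤] [LieAlgebra ℝ 𝔤]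
    (φ : 𝔤 ≃ₗ[ℝ] Submodule.span ℝ (Set.range h))
    (hφ : ∀ a b : 𝔤, IsBracket η (φ a : M → Fin k → ℝ) (φ b) (φ ⁅a, b⁆))
    (v : Module.Basis (Fin r) ℝ (Module.Dual ℝ 𝔤))
    (θ : Module.Dual ℝ (Fin k → ℝ))
    (hsub : IsEmbeddedSubmanifold E (zeroLevel v h θ))
    (hreg : ∀ x ∈ zeroLevel v h θ, ∀ w : TangentSpace 𝓘(ℝ, E) x,
      IsTangentAt (zeroLevel v h θ) x w ↔
        ∀ a : 𝔤, mfderiv 𝓘(ℝ, E) 𝓘(ℝ, ℝ) (fun y ↦ momentumMapAlong v h θ y a) x w = 0)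
    (htan : ∀ α, ∀ x ∈ zeroLevel v h θ,
      IsTangentAt (zeroLevel v h θ) x (reebDerivation η (h α) x)) :
    IsInvariantUnder X (zeroLevel v h θ) := by
  let θ' : (Fin k → ℝ) →L[ℝ] ℝ := LinearMap.toContinuousLinearMap θ
  have hθh : ∀ α, MDifferentiable 𝓘(ℝ, E) 𝓘(ℝ, ℝ) (θ ∘ h α) := fun α x ↦
    (hasMFDerivAt_comp_hamiltonian hη.smooth (hXs α).smooth (hXs α).eq_neg θ' x).mdifferentiableAt
  refine mainTheorem7_general η hη.smooth X Xs hX (fun α ↦ (hXs α).lieSymmetry) h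
    (fun α ↦ (hXs α).eq_neg) θ' _ (fun _ ↦ mem_zeroLevel_iff v) (fun x _ ↦ hη.surjective x) hsub
    (fun x hx w hw ↦ (hreg x hx w).2 fun a ↦ ?_)
    fun α x hx ↦ ⟨_, apply_reebDerivation hη (h α) x, extD_reebDerivation hη (h α) x, htan α x hx⟩
  rw [mfderiv_momentumMapAlong_apply v (fun α ↦ hθh α x)]
  exact Finset.sum_eq_zero fun α _ ↦ mul_eq_zero_of_right _ (hw α)
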